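/- A \emph{bimodal algebra} is a structure $\langle B,+,\cdot,-,0,1,f,g\rangle$ in which $\langle B,+,\cdot,-,0,1\rangle$ is a Boolean algebra (the one-element Boolean algebra is allowed) and $f,g:B\to B$ are modal operators, i.e. $f(0)=g(0)=0$, $f(x+y)=f(x)+f(y)$ and $g(x+y)=g(x)+g(y)$ for all $x,y\in B$. For an operator $h:B\to B$ let $h^\partial(x):=-h(-x)$. A \emph{discriminator decomposition algebra} (DDA) is a bimodal algebra $\langle B,f,g\rangle$, with $B$ nontrivial, such that $f(x)+g(x)=1$ for all $x\neq 0$. Let $\mathbf{DDA}$ be the class of all of them, and let $\mathbf{Eq}(\mathbf{DDA})$ be the equational class generated by $\mathbf{DDA}$, i.e. the smallest class of algebras of the similarity type $\langle +,\cdot,-,0,1,f,g\rangle$ that contains $\mathbf{DDA}$ and is axiomatized by a set of equations. A \emph{Kt-DDA} is a bimodal algebra $\langle B,f,g\rangle$ for which the operator $u(x):=f^\partial(x)\cdot g^\partial(x)$ satisfies the S5 axioms for a necessity operator, that is, for all $x\in B$, $$u(x)\le x,\qquad u(x)\le u(u(x)),\qquad x\le u(u^\partial(x)).$$ (Equivalently,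 $u^\partial(x)=f(x)+g(x)$ is an S5 possibility operator.) Let $\mathbf{KtDDA}$ be the class of all Kt-DDAs. **Theorem.** $\mathbf{Eq}(\mathbf{DDA})=\mathbf{KtDDA}$. -/

import Mathlib

universe u

namespace ModalDecomp

section Operators

variable {B : Type u} [BooleanAlgebra B]

/-- The dual operator `f^∂ (a) = - f (- a)`. -/
def dualOp (f : B → B) : B → B := fun a => (f aᶜ)ᶜ

/-- A modal operator: normal and additive. -/
structure IsModalOperator (f : B → B) : Prop where
  normal : f ⊥ = ⊥
  additive : ∀ x y : B, f (x ⊔ y) = f x ⊔ f y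

/-- A decomposing pair of modal operators: `f x + g x = 1` for all `x ≠ 0`. -/
structure IsDecomposingPair (f g : B → B) : Prop where
  modal_left : IsModalOperator f
  modal_right : IsModalOperator g
  decomposing : ∀ x : B, x ≠ ⊥ → f x ⊔ g x = ⊤

/-- The operator `u (x) = f^∂ (x) · g^∂ (x)`. -/
def meetDual (f g : B → B) : B → B := fun x => dualOp f x ⊓ dualOp g x

/-- The S5 axioms (T, 4, B) for a possibility operator `v`. -/
structure IsS5Possibility (v : B → B) : Prop where
  axiom_T : ∀ x : B, x ≤ v x
  axiom_4 : ∀ x : B, v (v x) ≤ v x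
  axiom_B : ∀ x : B, v (dualOp v x) ≤ x

/-- The S5 axioms (T, 4, B) for a necessity operator `w`. -/
structure IsS5Necessity (w : B → B) : Prop where
  axiom_T : ∀ x : B, w x ≤ x
  axiom_4 : ∀ x : B, w x ≤ w (w x)
  axiom_B : ∀ x : B, x ≤ w (dualOp w x)

/-- `w` is an S5 necessity operator if and only if its dual is an S5 possibility operator. -/
theorem isS5Necessity_iff_dual (w : B → B) :
    IsS5Necessity w ↔ IsS5Possibility (dualOp w) := by
  constructor
  · intro h
    refine ⟨fun x => ?_, fun x => ?_, fun x => ?_⟩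
    · exact le_compl_comm.mp (h.axiom_T xᶜ)
    · simpa [dualOp] using h.axiom_4 xᶜ
    · have := h.axiom_B xᶜ
      simp only [dualOp, compl_compl] at this ⊢
      exact compl_le_iff_compl_le.mp this
  · intro h
    refine ⟨fun x => ?_, fun x => ?_, fun x => ?_⟩
    · have := h.axiom_T xᶜ
      simpa [dualOp] using this
    · have := h.axiom_4 xᶜ
      simpa [dualOp] using this
    · have := h.axiom_B xᶜ
      simpa [dualOp] using this

end Operators

/-- The operation symbols of bimodal algebras `⟨B, +, ·, -, 0, 1, f, g⟩`. -/
inductive BimodalOp : ℕ → Type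
  | zero : BimodalOp 0
  | one : BimodalOp 0
  | compl : BimodalOp 1
  | opF : BimodalOp 1
  | opG : BimodalOp 1
  | add : BimodalOp 2
  | mul : BimodalOp 2

/-- The algebraic similarity type of bimodal algebras (no relation symbols). -/
def bimodalLang : FirstOrder.Language.{0, 0} := ⟨BimodalOp, fun _ => Empty⟩

/-- All algebras of this similarity type (with no laws assumed) on carriers in `Type u`. -/
abbrev Alg : Type (u + 1) := CategoryTheory.Bundled.{u} bimodalLang.Structure.{0, 0, u}

/-- An equation is a pair of terms in countably many variables. -/
abbrev Equation : Type := bimodalLang.Term ℕ × bimodalLang.Term ℕ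

/-- The algebra `A` satisfies the equation `e` identically. -/
def Satisfies (A : Alg.{u}) (e : Equation) : Prop :=
  ∀ v : ℕ → A, e.1.realize v = e.2.realize v

/-- The class of all algebras satisfying all equations of `E`. -/
def modelsOf (E : Set Equation) : Set Alg.{u} := {A | ∀ e ∈ E, Satisfies A e}

/-- Equational classes: classes axiomatized by a set of equations. -/
def IsEquationalClass (K : Set Alg.{u}) : Prop := ∃ E : Set Equation, K = modelsOf E

/-- `Eq(K)`, the equational class generated by `K`: the intersection of all equational classes
that contain `K`. -/
def eqClass (K : Set Alg.{u}) : Set Alg.{u} :=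
  {A | ∀ C : Set Alg.{u}, IsEquationalClass C → K ⊆ C → A ∈ C}

/-- `Eq(K)` consists of the algebras satisfying every equation that is valid in `K`. -/
theorem eqClass_eq_modelsOf (K : Set Alg.{u}) :
    eqClass K = modelsOf {e | ∀ A ∈ K, Satisfies A e} := by
  ext A
  constructor
  · intro h
    exact h _ ⟨_, rfl⟩ (fun A hA e he => he A hA)
  · rintro h C ⟨E, rfl⟩ hK e he
    exact h e (fun A' hA' => hK hA' e he)

/-- `Eq(K)` is itself an equational class. -/
theorem isEquationalClass_eqClass (K : Set Alg.{u}) : IsEquationalClass (eqClass K) :=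
  ⟨_, eqClass_eq_modelsOf K⟩

/-- The algebra `⟨B, +, ·, -, 0, 1, f, g⟩` given by a Boolean algebra `B` and two operators. -/
@[reducible] def bimodalStructure {B : Type u} [BooleanAlgebra B] (f g : B → B) :
    bimodalLang.Structure B where
  funMap {_} s := match s with
    | .zero => fun _ => ⊥
    | .one => fun _ => ⊤
    | .compl => fun x => (x 0)ᶜ
    | .opF => fun x => f (x 0)
    | .opG => fun x => g (x 0)
    | .add => fun x => x 0 ⊔ x 1
    | .mul => fun x => x 0 ⊓ x 1
  RelMap {_} r := r.elim

/-- The class of discriminator decomposition algebras: nontrivial Boolean algebras with a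
decomposing pair of modal operators. -/
def DDA : Set Alg.{u} :=
  {A | Nontrivial A ∧ ∃ (_ : BooleanAlgebra A) (f g : A → A),
    A.str = bimodalStructure f g ∧ IsDecomposingPair f g}

/-- The class of bimodal algebras, possibly with one element, for which
`u (x) = f^∂ (x) · g^∂ (x)` is an S5 (necessity) operator. -/
def KtDDA : Set Alg.{u} :=
  {A | ∃ (_ : BooleanAlgebra A) (f g : A → A),
    A.str = bimodalStructure f g ∧ IsModalOperator f ∧ IsModalOperator g ∧
      IsS5Necessity (meetDual f g)}

end ModalDecomp

/-! Write `v x = f x ⊔ g x`, the dual of `meetDual f g`. Kt-DDAs are the models of the finite list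
`ktEquations`, and in a DDA `v` sends 0 to 0 and everything else to 1, which is S5. This gives the
inclusion of `eqClass DDA` in `KtDDA`.

For the converse, let an equation fail in a Kt-DDA, and let `a ≠ 0` be the symmetric difference of
the two values. Take a prime ideal `P` that misses `a` and put `I = {x | v x ∈ P}`. Axiom 4 makes
`I` closed under `v`, hence under `f` and `g`; axiom T keeps `a` out of `I`. If `x ∉ I`, then
primality puts the complement of `v x` in `P`, and S5 makes that complement closed under `v`, so it
lies in `I`: modulo `I`, `v x` is 1. The quotient is thus a DDA in which the equation still fails.
-/

namespace ModalDecomp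

open FirstOrder FirstOrder.Language

/-! ### Equational axioms for Kt-DDAs -/

section Terms

/-- The term `0`. -/
def tZero : bimodalLang.Term ℕ := Constants.term (L := bimodalLang) BimodalOp.zero

/-- The term `1`. -/
def tOne : bimodalLang.Term ℕ := Constants.term (L := bimodalLang) BimodalOp.one

/-- The term `- s`. -/
def tCompl (s : bimodalLang.Term ℕ) : bimodalLang.Term ℕ :=
  Functions.apply₁ (L := bimodalLang) BimodalOp.compl s

/-- The term `f s`. -/
def tF (s : bimodalLang.Term ℕ) : bimodalLang.Term ℕ :=
  Functions.apply₁ (L := bimodalLang) BimodalOp.opF s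

/-- The term `g s`. -/
def tG (s : bimodalLang.Term ℕ) : bimodalLang.Term ℕ :=
  Functions.apply₁ (L := bimodalLang) BimodalOp.opG s

/-- The term `s + t`. -/
def tAdd (s t : bimodalLang.Term ℕ) : bimodalLang.Term ℕ :=
  Functions.apply₂ (L := bimodalLang) BimodalOp.add s t

/-- The term `s · t`. -/
def tMul (s t : bimodalLang.Term ℕ) : bimodalLang.Term ℕ :=
  Functions.apply₂ (L := bimodalLang) BimodalOp.mul s t

/-- The term `u s`, where `u (x) = f^∂ (x) · g^∂ (x)`. -/
def tU (s : bimodalLang.Term ℕ) : bimodalLang.Term ℕ :=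
  tMul (tCompl (tF (tCompl s))) (tCompl (tG (tCompl s)))

/-- The equations defining the class of Kt-DDAs. -/
def ktEquations : Set Equation :=
  let x : bimodalLang.Term ℕ := .var 0
  let y : bimodalLang.Term ℕ := .var 1
  let z : bimodalLang.Term ℕ := .var 2
  {(tAdd x y, tAdd y x), (tAdd (tAdd x y) z, tAdd x (tAdd y z)),
    (tMul x y, tMul y x), (tMul (tMul x y) z, tMul x (tMul y z)),
    (tAdd x (tMul x y), x), (tMul x (tAdd x y), x),
    (tMul x (tAdd y z), tAdd (tMul x y) (tMul x z)),
    (tAdd x tZero, x), (tMul x tOne, x),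
    (tMul x (tCompl x), tZero), (tAdd x (tCompl x), tOne),
    (tF tZero, tZero), (tF (tAdd x y), tAdd (tF x) (tF y)),
    (tG tZero, tZero), (tG (tAdd x y), tAdd (tG x) (tG y)),
    (tMul (tU x) x, tU x), (tMul (tU x) (tU (tU x)), tU x),
    (tMul x (tU (tCompl (tU (tCompl x)))), x)}

end Terms

section Realize

variable {B : Type u} [BooleanAlgebra B] (f g : B → B) (v : ℕ → B) (s t : bimodalLang.Term ℕ)

theorem realize_tZero : (letI := bimodalStructure f g; tZero.realize v) = ⊥ := rfl

theorem realize_tOne : (letI := bimodalStructure f g; tOne.realize v) = ⊤ := rfl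

theorem realize_tCompl :
    (letI := bimodalStructure f g; (tCompl s).realize v) =
      (letI := bimodalStructure f g; s.realize v)ᶜ := rfl

theorem realize_tF :
    (letI := bimodalStructure f g; (tF s).realize v) =
      f (letI := bimodalStructure f g; s.realize v) := rfl

theorem realize_tG :
    (letI := bimodalStructure f g; (tG s).realize v) =
      g (letI := bimodalStructure f g; s.realize v) := rfl

theorem realize_tAdd :
    (letI := bimodalStructure f g; (tAdd s t).realize v) =
      (letI := bimodalStructure f g; s.realize v) ⊔
        (letI := bimodalStructure f g; t.realize v) := rfl

theorem realize_tMul :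
    (letI := bimodalStructure f g; (tMul s t).realize v) =
      (letI := bimodalStructure f g; s.realize v) ⊓
        (letI := bimodalStructure f g; t.realize v) := rfl

theorem realize_tU :
    (letI := bimodalStructure f g; (tU s).realize v) =
      meetDual f g (letI := bimodalStructure f g; s.realize v) := rfl

end Realize

theorem eq_mk_bimodalStructure (A : Alg.{u}) [BooleanAlgebra A] {f g : A → A}
    (h : A.str = bimodalStructure f g) : A = ⟨A, bimodalStructure f g⟩ := by
  rw [← h]

theorem satisfies_ktEquations {B : Type u} [BooleanAlgebra B] {f g : B → B}
    (hf : IsModalOperator f) (hg : IsModalOperator g) (hu : IsS5Necessity (meetDual f g)) :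
    (⟨B, bimodalStructure f g⟩ : Alg.{u}) ∈ modelsOf ktEquations := by
  intro e he v
  change @Term.realize _ _ (bimodalStructure f g) _ v e.1 =
    @Term.realize _ _ (bimodalStructure f g) _ v e.2
  simp only [ktEquations, Set.mem_insert_iff, Set.mem_singleton_iff] at he
  rcases he with rfl | rfl | rfl | rfl | rfl | rfl | rfl | rfl | rfl | rfl | rfl | rfl | rfl | rfl |
    rfl | rfl | rfl | rfl <;>
    simp only [realize_tZero, realize_tOne, realize_tCompl, realize_tF, realize_tG, realize_tAdd,
      realize_tMul, realize_tU, Term.realize_var]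
  · exact sup_comm _ _
  · exact sup_assoc _ _ _
  · exact inf_comm _ _
  · exact inf_assoc _ _ _
  · exact sup_inf_self
  · exact inf_sup_self
  · exact inf_sup_left _ _ _
  · exact sup_bot_eq _
  · exact inf_top_eq _
  · exact inf_compl_eq_bot
  · exact sup_compl_eq_top
  · exact hf.normal
  · exact hf.additive _ _
  · exact hg.normal
  · exact hg.additive _ _
  · exact inf_eq_left.2 (hu.axiom_T _)
  · exact inf_eq_left.2 (hu.axiom_4 _)
  · exact inf_eq_left.2 (hu.axiom_B _)

/-- The Boolean algebra given by a join, a meet, a complement and two constants that satisfy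
equational axioms. -/
abbrev booleanAlgebraOfEquations {B : Type u} (s m : B → B → B) (c : B → B) (z o : B)
    (s_comm : ∀ x y, s x y = s y x) (s_assoc : ∀ x y w, s (s x y) w = s x (s y w))
    (m_comm : ∀ x y, m x y = m y x) (m_assoc : ∀ x y w, m (m x y) w = m x (m y w))
    (s_m_self : ∀ x y, s x (m x y) = x) (m_s_self : ∀ x y, m x (s x y) = x)
    (m_s : ∀ x y w, m x (s y w) = s (m x y) (m x w))
    (s_zero : ∀ x, s x z = x) (m_one : ∀ x, m x o = x)
    (m_compl : ∀ x, m x (c x) = z) (s_compl : ∀ x, s x (c x) = o) : BooleanAlgebra B :=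
  letI : Max B := ⟨s⟩
  letI : Min B := ⟨m⟩
  letI : Lattice B := Lattice.mk' s_comm s_assoc m_comm m_assoc s_m_self m_s_self
  letI : DistribLattice B := DistribLattice.ofInfSupLe fun x y w => (m_s x y w).le
  { (inferInstance : DistribLattice B) with
    compl := c
    bot := z
    top := o
    sdiff := fun x y => m x (c y)
    himp := fun x y => s y (c x)
    inf_compl_le_bot := fun x => (m_compl x).le
    top_le_sup_compl := fun x => (s_compl x).ge
    le_top := fun x => inf_eq_left.1 (m_one x)
    bot_le := fun x => sup_eq_left.1 (s_zero x)
    sdiff_eq := fun _ _ => rfl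
    himp_eq := fun _ _ => rfl }

/-- The valuation that sends the first three variables to `x`, `y` and `z`. -/
def valuation₃ {B : Type u} (x y z : B) : ℕ → B
  | 0 => x
  | 1 => y
  | _ => z

theorem mem_KtDDA_of_satisfies_ktEquations {A : Alg.{u}} (hA : A ∈ modelsOf ktEquations) :
    A ∈ KtDDA := by
  obtain ⟨A, str⟩ := A
  let s : A → A → A := fun x y => Structure.funMap (L := bimodalLang) BimodalOp.add ![x, y]
  let m : A → A → A := fun x y => Structure.funMap (L := bimodalLang) BimodalOp.mul ![x, y]
  let c : A → A := fun x => Structure.funMap (L := bimodalLang) BimodalOp.compl ![x]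
  let f : A → A := fun x => Structure.funMap (L := bimodalLang) BimodalOp.opF ![x]
  let g : A → A := fun x => Structure.funMap (L := bimodalLang) BimodalOp.opG ![x]
  let z : A := Structure.funMap (L := bimodalLang) BimodalOp.zero ![]
  let o : A := Structure.funMap (L := bimodalLang) BimodalOp.one ![]
  let u : A → A := fun x => m (c (f (c x))) (c (g (c x)))
  have rVar (v : ℕ → A) (n) : (Term.var n : bimodalLang.Term ℕ).realize v = v n := rfl
  have rZ (v : ℕ → A) : tZero.realize v = z :=
    congrArg (str.funMap (n := 0) BimodalOp.zero) (Subsingleton.elim _ _)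
  have rO (v : ℕ → A) : tOne.realize v = o :=
    congrArg (str.funMap (n := 0) BimodalOp.one) (Subsingleton.elim _ _)
  have rC (v : ℕ → A) (t) : (tCompl t).realize v = c (t.realize v) :=
    Term.realize_functions_apply₁
  have rF (v : ℕ → A) (t) : (tF t).realize v = f (t.realize v) :=
    Term.realize_functions_apply₁
  have rG (v : ℕ → A) (t) : (tG t).realize v = g (t.realize v) :=
    Term.realize_functions_apply₁
  have rA (v : ℕ → A) (t t') : (tAdd t t').realize v = s (t.realize v) (t'.realize v) :=
    Term.realize_functions_apply₂
  have rM (v : ℕ → A) (t t') : (tMul t t').realize v = m (t.realize v) (t'.realize v) :=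
    Term.realize_functions_apply₂
  have rU (v : ℕ → A) (t) : (tU t).realize v = u (t.realize v) := by
    simp only [tU, rM, rC, rF, rG, u]
  have key : ∀ e ∈ ktEquations, ∀ x y w : A,
      e.1.realize (valuation₃ x y w) = e.2.realize (valuation₃ x y w) :=
    fun e he x y w => hA e he _
  simp only [ktEquations, Set.mem_insert_iff, Set.mem_singleton_iff, forall_eq_or_imp, forall_eq,
    rZ, rO, rC, rF, rG, rA, rM, rU, rVar, valuation₃] at key
  obtain ⟨h1, h2, h3, h4, h5, h6, h7, h8, h9, h10, h11, h12, h13, h14, h15, h16, h17, h18⟩ := key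
  -- Each equation is quantified over three elements; variables that do not occur get arbitrary
  -- values.
  let BA : BooleanAlgebra A := booleanAlgebraOfEquations s m c z o
    (fun x y => h1 x y x) h2 (fun x y => h3 x y x) h4 (fun x y => h5 x y x) (fun x y => h6 x y x)
    h7 (fun x => h8 x x x) (fun x => h9 x x x) (fun x => h10 x x x) (fun x => h11 x x x)
  refine ⟨BA, f, g, ?_, ⟨h12 z z z, fun x y => h13 x y x⟩, ⟨h14 z z z, fun x y => h15 x y x⟩,
    ⟨fun x => inf_eq_left.1 (h16 x x x), fun x => inf_eq_left.1 (h17 x x x),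
      fun x => inf_eq_left.1 (h18 x x x)⟩⟩
  refine Structure.ext ?_ ?_
  · funext n op x
    cases op with
    | zero => exact congrArg _ (Subsingleton.elim _ _)
    | one => exact congrArg _ (Subsingleton.elim _ _)
    | compl =>
      -- The tuples `x` and `![x 0]` have definitionally equal lists of entries, so `List.ofFn`
      -- being injective identifies them.
      exact congrArg (str.funMap (n := 1) BimodalOp.compl) (List.ofFn_inj.1 rfl)
    | opF =>
      exact congrArg (str.funMap (n := 1) BimodalOp.opF) (List.ofFn_inj.1 rfl)
    | opG =>
      exact congrArg (str.funMap (n := 1) BimodalOp.opG) (List.ofFn_inj.1 rfl)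
    | add =>
      exact congrArg (str.funMap (n := 2) BimodalOp.add) (List.ofFn_inj.1 rfl)
    | mul =>
      exact congrArg (str.funMap (n := 2) BimodalOp.mul) (List.ofFn_inj.1 rfl)
  · funext n r
    exact r.elim

theorem KtDDA_eq_modelsOf : KtDDA.{u} = modelsOf ktEquations :=
  Set.ext fun A => ⟨fun ⟨_, _, _, h, hf, hg, hu⟩ =>
    eq_mk_bimodalStructure A h ▸ satisfies_ktEquations hf hg hu,
    mem_KtDDA_of_satisfies_ktEquations⟩

/-! ### DDAs are Kt-DDAs -/

section Operators

variable {B : Type u} [BooleanAlgebra B] {f g : B → B}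

theorem IsModalOperator.monotone (hf : IsModalOperator f) : Monotone f := fun x y h => by
  rw [← sup_eq_right.2 h, hf.additive]
  exact le_sup_left

theorem dualOp_meetDual (f g : B → B) : dualOp (meetDual f g) = fun x => f x ⊔ g x := by
  funext x
  simp [dualOp, meetDual, compl_inf]

/-- The sum is 0 at 0 and 1 elsewhere, so each axiom reduces to a case split on whether its argument
(for B, the complement) is 0. -/
theorem IsDecomposingPair.isS5Possibility (h : IsDecomposingPair f g) :
    IsS5Possibility fun x => f x ⊔ g x := by
  have h0 : f ⊥ ⊔ g ⊥ = ⊥ := by rw [h.modal_left.normal, h.modal_right.normal, sup_bot_eq]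
  refine ⟨fun x => ?_, fun x => ?_, fun x => ?_⟩
  · by_cases hx : x = ⊥
    · simp [hx]
    · simp [h.decomposing x hx]
  · by_cases hx : x = ⊥
    · simp [hx, h0]
    · simp [h.decomposing x hx]
  · by_cases hx : xᶜ = ⊥
    · simp [compl_eq_bot.1 hx]
    · simp [dualOp, h.decomposing _ hx, h0]

theorem DDA_subset_KtDDA : DDA.{u} ⊆ KtDDA := by
  rintro A ⟨-, BA, f, g, hA, h⟩
  refine ⟨BA, f, g, hA, h.modal_left, h.modal_right, (isS5Necessity_iff_dual _).2 ?_⟩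
  rw [dualOp_meetDual]
  exact h.isS5Possibility

end Operators

/-! ### Quotients by ideals closed under the operators -/

section Quotient

variable {B : Type u} [BooleanAlgebra B]

/-- The equality modulo an ideal of a Boolean algebra. -/
def idealSetoid (I : Order.Ideal B) : Setoid B where
  r x y := ∃ i ∈ I, x ⊔ i = y ⊔ i
  iseqv :=
    { refl := fun _ => ⟨⊥, I.bot_mem, rfl⟩
      symm := fun ⟨i, hi, h⟩ => ⟨i, hi, h.symm⟩
      trans := by
        rintro x y z ⟨i, hi, h⟩ ⟨j, hj, h'⟩
        refine ⟨i ⊔ j, Order.Ideal.sup_mem hi hj, ?_⟩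
        rw [← sup_assoc, h, sup_right_comm, h', sup_right_comm, sup_assoc] }

variable {I : Order.Ideal B} {x y x' y' : B}

theorem idealSetoid_sup (h : idealSetoid I x y) (h' : idealSetoid I x' y') :
    idealSetoid I (x ⊔ x') (y ⊔ y') := by
  obtain ⟨i, hi, h⟩ := h
  obtain ⟨j, hj, h'⟩ := h'
  refine ⟨i ⊔ j, Order.Ideal.sup_mem hi hj, ?_⟩
  rw [sup_sup_sup_comm, h, h', sup_sup_sup_comm]

theorem idealSetoid_compl (h : idealSetoid I x y) : idealSetoid I xᶜ yᶜ := by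
  obtain ⟨i, hi, h⟩ := h
  refine ⟨i, hi, ?_⟩
  -- The left side thus depends on `w` only through `w ⊔ i`.
  have key (w : B) : wᶜ ⊔ i = (w ⊔ i)ᶜ ⊔ i := by
    rw [compl_sup, sup_inf_right, compl_sup_eq_top, inf_top_eq]
  rw [key x, key y, h]

theorem idealSetoid_inf (h : idealSetoid I x y) (h' : idealSetoid I x' y') :
    idealSetoid I (x ⊓ x') (y ⊓ y') := by
  simpa using idealSetoid_compl (idealSetoid_sup (idealSetoid_compl h) (idealSetoid_compl h'))

theorem idealSetoid_modal {f : B → B} (hf : IsModalOperator f) (hI : ∀ i ∈ I, f i ∈ I)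
    (h : idealSetoid I x y) : idealSetoid I (f x) (f y) := by
  obtain ⟨i, hi, h⟩ := h
  exact ⟨f i, hI i hi, by rw [← hf.additive, h, hf.additive]⟩

theorem idealSetoid_bot_iff : idealSetoid I x ⊥ ↔ x ∈ I :=
  ⟨fun ⟨_, hi, h⟩ => I.lower (le_sup_left.trans (h.trans (bot_sup_eq _)).le) hi,
    fun h => ⟨x, h, by simp⟩⟩

theorem idealSetoid_top_iff : idealSetoid I x ⊤ ↔ xᶜ ∈ I := by
  rw [← idealSetoid_bot_iff]
  exact ⟨fun h => by simpa using idealSetoid_compl h, fun h => by simpa using idealSetoid_compl h⟩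

/-- Used contrapositively: an ideal that misses the symmetric difference keeps the two classes
apart. -/
theorem symmDiff_mem_of_idealSetoid (h : idealSetoid I x y) : symmDiff x y ∈ I := by
  obtain ⟨i, hi, h⟩ := h
  refine I.lower (symmDiff_le ?_ ?_) hi
  · exact le_sup_left.trans h.le
  · exact le_sup_left.trans h.ge

/-- The quotient of a bimodal algebra by an ideal that is closed under both operators. -/
@[reducible] def idealPrestructure {f g : B → B} (hf : IsModalOperator f) (hg : IsModalOperator g)
    (hfI : ∀ i ∈ I, f i ∈ I) (hgI : ∀ i ∈ I, g i ∈ I) :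
    bimodalLang.Prestructure (idealSetoid I) where
  toStructure := bimodalStructure f g
  fun_equiv {n} op x y h := by
    cases op with
    | zero => exact (idealSetoid I).refl _
    | one => exact (idealSetoid I).refl _
    | compl => exact idealSetoid_compl (h 0)
    | opF => exact idealSetoid_modal hf hfI (h 0)
    | opG => exact idealSetoid_modal hg hgI (h 0)
    | add => exact idealSetoid_sup (h 0) (h 1)
    | mul => exact idealSetoid_inf (h 0) (h 1)
  rel_equiv {n} r := r.elim

end Quotient

/-- Equations are preserved by quotients. -/
theorem satisfies_quotient {M : Type u} (s : Setoid M) [ps : bimodalLang.Prestructure s]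
    {e : Equation} (h : Satisfies ⟨M, ps.toStructure⟩ e) :
    Satisfies ⟨Quotient s, quotientStructure⟩ e := by
  intro v
  obtain ⟨w, rfl⟩ : ∃ w : ℕ → M, v = fun n => (⟦w n⟧ : Quotient s) :=
    ⟨fun n => (v n).out, funext fun n => (Quotient.out_eq (v n)).symm⟩
  refine (Term.realize_quotient_mk' s e.1 w).trans (Eq.trans ?_
    (Term.realize_quotient_mk' s e.2 w).symm)
  exact congrArg _ (h w)

/-! ### Separating nonzero elements from 0 by DDA quotients -/

section Separation

variable {B : Type u} [BooleanAlgebra B] {f g : B → B}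

/-- The ideal of all `x` for which `v (x)` belongs to the ideal `P`. -/
def preimageIdeal {v : B → B} (hv : IsModalOperator v) (P : Order.Ideal B) : Order.Ideal B :=
  Order.IsIdeal.toIdeal (I := {x | v x ∈ P})
    { IsLowerSet := fun _ _ h hx => P.lower (hv.monotone h) hx
      Nonempty := ⟨⊥, by simp [hv.normal]⟩
      Directed := fun x hx y hy => ⟨x ⊔ y, by
        simpa [hv.additive] using And.intro hx hy, le_sup_left, le_sup_right⟩ }

theorem IsModalOperator.sup (hf : IsModalOperator f) (hg : IsModalOperator g) :
    IsModalOperator fun x => f x ⊔ g x :=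
  ⟨by simp [hf.normal, hg.normal], fun x y => by
    simp only [hf.additive, hg.additive]; exact sup_sup_sup_comm _ _ _ _⟩

theorem exists_isPrime_notMem {a : B} (ha : a ≠ ⊥) : ∃ P : Order.Ideal B, P.IsPrime ∧ a ∉ P := by
  obtain ⟨P, hP, -, hd⟩ := DistribLattice.prime_ideal_of_disjoint_filter_ideal
    (F := Order.PFilter.principal a) (I := Order.Ideal.principal (⊥ : B)) (by
      rw [Set.disjoint_left]
      intro x hx hx'
      exact ha (le_bot_iff.1 (le_trans (Order.PFilter.mem_principal.1 hx)
        (Order.Ideal.mem_principal.1 hx'))))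
  exact ⟨P, hP, Set.disjoint_left.1 hd (Order.PFilter.mem_principal.2 le_rfl)⟩

/-- By T and 4, `v x` is a fixed point of `v`, so its complement is a fixed point of the dual; axiom
B at this complement is the claim. -/
theorem IsS5Possibility.compl_le {v : B → B} (hv : IsS5Possibility v) (x : B) :
    v (v x)ᶜ ≤ (v x)ᶜ := by
  have h : v (v x) = v x := le_antisymm (hv.axiom_4 x) (hv.axiom_T _)
  simpa [dualOp, h] using hv.axiom_B (v x)ᶜ

/-- Every nonzero element of a Kt-DDA remains nonzero in some quotient that is a DDA. -/
theorem exists_prestructure_mem_DDA (hf : IsModalOperator f) (hg : IsModalOperator g)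
    (hu : IsS5Necessity (meetDual f g)) {a : B} (ha : a ≠ ⊥) :
    ∃ (I : Order.Ideal B) (ps : bimodalLang.Prestructure (idealSetoid I)),
      ps.toStructure = bimodalStructure f g ∧ a ∉ I ∧
        (⟨Quotient (idealSetoid I), quotientStructure⟩ : Alg.{u}) ∈ DDA := by
  obtain ⟨P, hP, haP⟩ := exists_isPrime_notMem ha
  have hv := hf.sup hg
  have hS5 : IsS5Possibility fun x => f x ⊔ g x := by
    rw [← dualOp_meetDual]
    exact (isS5Necessity_iff_dual _).1 hu
  let I := preimageIdeal hv P
  have hI {x : B} (hx : x ∈ I) : f x ⊔ g x ∈ I := P.lower (hS5.axiom_4 x) hx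
  have haI : a ∉ I := fun h => haP (P.lower (hS5.axiom_T a) h)
  have hc {x : B} (hx : x ∉ I) : (f x ⊔ g x)ᶜ ∈ I :=
    P.lower (hS5.compl_le x) (hP.compl_mem_of_notMem hx)
  let ps : bimodalLang.Prestructure (idealSetoid I) := idealPrestructure hf hg
    (fun i hi => I.lower le_sup_left (hI hi)) (fun i hi => I.lower le_sup_right (hI hi))
  refine ⟨I, ps, rfl, haI, ?_, ?_⟩
  · refine ⟨(⟦a⟧ : Quotient (idealSetoid I)), (⟦⊥⟧ : Quotient (idealSetoid I)), fun h => ?_⟩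
    exact haI (idealSetoid_bot_iff.1 (Quotient.exact h))
  -- The equations pass to the quotient, which supplies its Boolean algebra and modal operators.
  · have hmem : (⟨Quotient (idealSetoid I), quotientStructure⟩ : Alg.{u}) ∈ KtDDA := by
      rw [KtDDA_eq_modelsOf]
      intro e he
      exact satisfies_quotient _ (satisfies_ktEquations hf hg hu e he)
    obtain ⟨BA, f', g', hstr, hf', hg', -⟩ := hmem
    refine ⟨BA, f', g', hstr, hf', hg', fun q hq => ?_⟩
    -- The Boolean algebra obtained is known only through `hstr`; this computes its operations on
    -- representatives.
    have hfun {n : ℕ} (op : BimodalOp n) (x : Fin n → B) :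
        (bimodalStructure f' g').funMap (n := n) op (fun i => (⟦x i⟧ : Quotient (idealSetoid I))) =
          ⟦(bimodalStructure f g).funMap (n := n) op x⟧ := by
      rw [← hstr]
      exact funMap_quotient_mk' (L := bimodalLang) _ op x
    obtain ⟨x, rfl⟩ := Quotient.exists_rep q
    have hbot : (⊥ : Quotient (idealSetoid I)) = ⟦⊥⟧ := hfun BimodalOp.zero ![]
    have htop : (⊤ : Quotient (idealSetoid I)) = ⟦⊤⟧ := hfun BimodalOp.one ![]
    have hF : f' ⟦x⟧ = ⟦f x⟧ := hfun BimodalOp.opF ![x]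
    have hG : g' ⟦x⟧ = ⟦g x⟧ := hfun BimodalOp.opG ![x]
    have hsup : (⟦f x⟧ ⊔ ⟦g x⟧ : Quotient (idealSetoid I)) = ⟦f x ⊔ g x⟧ :=
      hfun BimodalOp.add ![f x, g x]
    have hx : x ∉ I := fun h => hq (hbot ▸ Quotient.sound (idealSetoid_bot_iff.2 h))
    have hxt : (⟦f x ⊔ g x⟧ : Quotient (idealSetoid I)) = ⟦⊤⟧ :=
      Quotient.sound (idealSetoid_top_iff.2 (hc hx))
    change f' ⟦x⟧ ⊔ g' ⟦x⟧ = ⊤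
    rw [hF, hG, hsup, htop, hxt]

end Separation

/-! ### Transfer of failing equations to DDAs -/

theorem KtDDA_subset_eqClass_DDA : KtDDA.{u} ⊆ eqClass DDA := by
  rintro A ⟨BA, f, g, hstr, hf, hg, hu⟩
  rw [eqClass_eq_modelsOf, eq_mk_bimodalStructure A hstr]
  intro e he v
  by_contra hne
  obtain ⟨I, ps, hps, haI, hI⟩ :=
    exists_prestructure_mem_DDA hf hg hu (fun h => hne (symmDiff_eq_bot.1 h))
  have h := he _ hI fun n => (⟦v n⟧ : Quotient (idealSetoid I))
  have h' := (Term.realize_quotient_mk' (idealSetoid I) e.1 v).symm.trans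
    (h.trans (Term.realize_quotient_mk' (idealSetoid I) e.2 v))
  rw [hps] at h'
  exact haI (symmDiff_mem_of_idealSetoid (Quotient.exact h'))

end ModalDecomp

theorem mainTheorem6 : ModalDecomp.eqClass.{u} ModalDecomp.DDA = ModalDecomp.KtDDA :=
  Set.Subset.antisymm
    (fun _ hA => hA _ ⟨_, ModalDecomp.KtDDA_eq_modelsOf⟩ ModalDecomp.DDA_subset_KtDDA)
    ModalDecomp.KtDDA_subset_eqClass_DDA
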